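/- Let $q:(0,\infty)\to\mathbb{C}$ be in $L^1(0,\infty)$ and let $\gamma>0$. For $R>0$ let $H_R=-\frac{d^2}{dx^2}+q+i\gamma\chi_{[0,R]}$ be the Schrödinger operator on $L^2(0,\infty)$ with Dirichlet boundary condition at $0$: its domain consists of all $f\in L^2(0,\infty)$ such that $f$ and $f'$ are locally absolutely continuous on $[0,\infty)$, $f(0)=0$ and $-f''+qf+i\gamma\chi_{[0,R]}f\in L^2(0,\infty)$. A number $\lambda\in\mathbb{C}$ is an eigenvalue of $H_R$ if $H_Rf=\lambda f$ for some $f\neq0$ in the domain. Put $\Gamma_\gamma=\{\lambda\in\mathbb{C}:\operatorname{Re}\lambda>0,\ 0<\operatorname{Im}\lambda<\gamma\}$ and $B_X(0)=\{\lambda\in\mathbb{C}:|\lambda|<X\}$. (a) There exists $X=X(q,\gamma)>0$ such that, for every $R>0$, all eigenvalues of $H_R$ lie in $B_X(0)\cup\Gamma_\gamma$. (b) There exists $R_0=R_0(q,\gamma)>1$ such that, for every $R\ge R_0$, every eigenvalue $\lambda$ of $H_R$ in $\Gamma_\gamma$ satisfies $$\sqrt{|\lambda-i\gamma|}\le\frac{5\gamma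 R}{\log R}.$$ -/

import Mathlib

open MeasureTheory Set

/-- The complex Hilbert space `L²(0,∞)`. -/
abbrev L2HalfLine : Type := Lp ℂ 2 (volume.restrict (Ioi (0 : ℝ)))

/-- `f` is locally absolutely continuous on `[0,∞)` with almost everywhere derivative `g`:
`g` is integrable on every `[0,x]`, and `f x = f 0 + ∫₀ˣ g`. -/
structure HasACDeriv (f g : ℝ → ℂ) : Prop where
  intervalIntegrable : ∀ x : ℝ, 0 ≤ x → IntervalIntegrable g volume 0 x
  eq_integral : ∀ x : ℝ, 0 ≤ x → f x = f 0 + ∫ t in (0 : ℝ)..x, g t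

theorem HasACDeriv.zero : HasACDeriv 0 0 :=
  ⟨fun _ _ => intervalIntegrable_const (c := (0 : ℂ)), fun _ _ => by simp⟩

theorem HasACDeriv.add {f₁ g₁ f₂ g₂ : ℝ → ℂ} (h₁ : HasACDeriv f₁ g₁) (h₂ : HasACDeriv f₂ g₂) :
    HasACDeriv (f₁ + f₂) (g₁ + g₂) := by
  refine ⟨fun x hx => (h₁.1 x hx).add (h₂.1 x hx), fun x hx => ?_⟩
  simp only [Pi.add_apply]
  rw [intervalIntegral.integral_add (h₁.1 x hx) (h₂.1 x hx), h₁.2 x hx, h₂.2 x hx]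
  ring

theorem HasACDeriv.smul {f g : ℝ → ℂ} (c : ℂ) (h : HasACDeriv f g) :
    HasACDeriv (c • f) (c • g) := by
  refine ⟨fun x hx => (h.1 x hx).smul c, fun x hx => ?_⟩
  simp only [Pi.smul_apply]
  rw [intervalIntegral.integral_smul, h.2 x hx, smul_add]

theorem HasACDeriv.continuousOn {f g : ℝ → ℂ} (h : HasACDeriv f g) :
    ContinuousOn f (Ici 0) := by
  intro x hx
  have hx0 : (0 : ℝ) ≤ x := hx
  have hI := h.1 (x + 1) (by linarith)
  have hc : ContinuousOn (fun y => f 0 + ∫ t in (0 : ℝ)..y, g t) (Icc 0 (x + 1)) := by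
    refine continuousOn_const.add ?_
    have := intervalIntegral.continuousOn_primitive_interval' hI left_mem_uIcc
    rwa [uIcc_of_le (by linarith)] at this
  have hf : ContinuousOn f (Icc 0 (x + 1)) := hc.congr fun y hy => h.2 y hy.1
  refine (hf x ⟨hx0, by linarith⟩).mono_of_mem_nhdsWithin ?_
  have h1 : Iio (x + 1) ∈ nhds x := Iio_mem_nhds (by linarith)
  filter_upwards [self_mem_nhdsWithin, mem_nhdsWithin_of_mem_nhds h1] with y hy hy'
  exact ⟨hy, le_of_lt hy'⟩

/-- An absolutely continuous function that vanishes almost everywhere vanishes identically on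
`[0,∞)`, and so does its derivative, almost everywhere. -/
theorem HasACDeriv.eq_zero {f g : ℝ → ℂ} (h : HasACDeriv f g)
    (hf : f =ᵐ[volume.restrict (Ioi (0 : ℝ))] 0) :
    EqOn f 0 (Ici 0) ∧ g =ᵐ[volume.restrict (Ioi (0 : ℝ))] 0 := by
  have hz : EqOn f 0 (Ici 0) := by
    refine Measure.eqOn_of_ae_eq (μ := (volume : Measure ℝ)) ?_ h.continuousOn
      continuousOn_const (by simp)
    rwa [← Measure.restrict_congr_set (Ioi_ae_eq_Ici (a := (0 : ℝ)) (μ := volume))]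
  refine ⟨hz, ?_⟩
  have key : ∀ n : ℕ, ∀ᵐ x : ℝ, x ∈ uIcc (0 : ℝ) n → ∀ c ∈ uIcc (0 : ℝ) n,
      HasDerivAt (fun y => ∫ t in c..y, g t) (g x) x := fun n =>
    (h.1 n (Nat.cast_nonneg n)).ae_hasDerivAt_integral
  rw [← ae_all_iff] at key
  rw [Filter.EventuallyEq, ae_restrict_iff' measurableSet_Ioi]
  filter_upwards [key] with x hx hx0
  have hx0' : (0 : ℝ) < x := hx0
  obtain ⟨n, hn⟩ := exists_nat_ge x
  have hd := hx n (by rw [uIcc_of_le (by positivity)]; exact ⟨hx0'.le, hn⟩) 0 left_mem_uIcc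
  have hd' : HasDerivAt (fun _ : ℝ => (0 : ℂ)) (g x) x := by
    refine hd.congr_of_eventuallyEq ?_
    filter_upwards [Ioi_mem_nhds hx0'] with y hy
    have h1 := h.2 y (le_of_lt (show (0 : ℝ) < y from hy))
    have h2 : f y = 0 := hz (show (0 : ℝ) ≤ y from le_of_lt (show (0 : ℝ) < y from hy))
    have h3 : f 0 = 0 := hz self_mem_Ici
    rw [h2, h3, zero_add] at h1
    exact h1
  exact hd'.unique (hasDerivAt_const x (0 : ℂ))

/-- `(u, w)` is in the graph of the Dirichlet realization of `-d²/dx² + V` on `L²(0,∞)`: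
`u` has a representative `f` such that `f` and `f'` are locally absolutely continuous on `[0,∞)`,
`f(0) = 0`, and `-f'' + V f` is (a representative of) `w`, an element of `L²(0,∞)`. -/
def IsDirichletPair (V : ℝ → ℂ) (u w : L2HalfLine) : Prop :=
  ∃ f f' f'' : ℝ → ℂ,
    (u =ᵐ[volume.restrict (Ioi (0 : ℝ))] f) ∧
    f 0 = 0 ∧ HasACDeriv f f' ∧ HasACDeriv f' f'' ∧
    (w =ᵐ[volume.restrict (Ioi (0 : ℝ))] fun x => -f'' x + V x * f x)

/-- The graph of the Dirichlet realization of `-d²/dx² + V`, as a subspace of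
`L²(0,∞) × L²(0,∞)`. -/
def schrodingerGraph (V : ℝ → ℂ) : Submodule ℂ (L2HalfLine × L2HalfLine) where
  carrier := {p | IsDirichletPair V p.1 p.2}
  zero_mem' := by
    refine ⟨0, 0, 0, Lp.coeFn_zero _ _ _, rfl, HasACDeriv.zero, HasACDeriv.zero, ?_⟩
    filter_upwards [Lp.coeFn_zero ℂ 2 (volume.restrict (Ioi (0 : ℝ)))] with x hx
    simpa using hx
  add_mem' := by
    rintro ⟨u₁, w₁⟩ ⟨u₂, w₂⟩ ⟨f, f', f'', hu, h0, h1, h2, hw⟩ ⟨k, k', k'', ku, k0, k1, k2, kw⟩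
    refine ⟨f + k, f' + k', f'' + k'', ?_, by simp [h0, k0], h1.add k1, h2.add k2, ?_⟩
    · exact (Lp.coeFn_add u₁ u₂).trans (hu.add ku)
    · filter_upwards [Lp.coeFn_add w₁ w₂, hw, kw] with x hx h k
      simp only [Prod.mk_add_mk, hx, Pi.add_apply, h, k]
      ring
  smul_mem' := by
    rintro c ⟨u, w⟩ ⟨f, f', f'', hu, h0, h1, h2, hw⟩
    refine ⟨c • f, c • f', c • f'', ?_, by simp [h0], h1.smul c, h2.smul c, ?_⟩
    · exact (Lp.coeFn_smul c u).trans (hu.const_smul c)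
    · filter_upwards [Lp.coeFn_smul c w, hw] with x hx h
      simp only [Prod.smul_mk, hx, Pi.smul_apply, h, smul_eq_mul]
      ring

/-- The graph is single-valued. -/
theorem schrodingerGraph_snd_eq_zero (V : ℝ → ℂ) (p : L2HalfLine × L2HalfLine)
    (hp : p ∈ schrodingerGraph V) (h0 : p.1 = 0) : p.2 = 0 := by
  obtain ⟨f, f', f'', hu, -, h1, h2, hw⟩ := hp
  have hf : f =ᵐ[volume.restrict (Ioi (0 : ℝ))] 0 := by
    rw [h0] at hu
    exact hu.symm.trans (Lp.coeFn_zero _ _ _)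
  have hf'' := (h2.eq_zero (h1.eq_zero hf).2).2
  rw [Lp.eq_zero_iff_ae_eq_zero]
  filter_upwards [hw, hf, hf''] with x hx h h''
  simp [hx, h, h'']

/-- The Schrödinger operator `-d²/dx² + V` on `L²(0,∞)` with Dirichlet condition at `0`, as an
unbounded operator with its maximal domain. -/
noncomputable def schrodingerOp (V : ℝ → ℂ) : L2HalfLine →ₗ.[ℂ] L2HalfLine :=
  (schrodingerGraph V).toLinearPMap

/-- The operator is the one described by `IsDirichletPair`. -/
theorem mem_graph_schrodingerOp {V : ℝ → ℂ} {u w : L2HalfLine} :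
    (u, w) ∈ (schrodingerOp V).graph ↔ IsDirichletPair V u w := by
  rw [schrodingerOp, Submodule.toLinearPMap_graph_eq _ (schrodingerGraph_snd_eq_zero V)]
  exact Iff.rfl

/-- `H_R = -d²/dx² + q + iγ χ_[0,R]` on `L²(0,∞)` with Dirichlet condition at `0`. -/
noncomputable def barrierOp (q : ℝ → ℂ) (γ R : ℝ) : L2HalfLine →ₗ.[ℂ] L2HalfLine :=
  schrodingerOp fun x => q x + Complex.I * γ * (Icc (0 : ℝ) R).indicator 1 x

/-- `z` is an eigenvalue of the unbounded operator `T`. -/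
def IsEigenvalue {E : Type*} [AddCommGroup E] [Module ℂ E] (T : E →ₗ.[ℂ] E) (z : ℂ) : Prop :=
  ∃ u : T.domain, u ≠ 0 ∧ T u = z • (u : E)

/-- The strip `Γ_γ = (0,∞) × i(0,γ)`. -/
def strip (γ : ℝ) : Set ℂ := {z | 0 < z.re ∧ 0 < z.im ∧ z.im < γ}

/-! Let `m² = z - iγ` and `k² = z` with `m`, `k` in the closed upper half-plane, and let `Q = ‖q‖₁`.
On `[0,R]` an eigenfunction solves `f'' = (q - m²)f`. Beyond `R` it solves `f'' = (q - k²)f` and,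
being square-integrable, it decays. For each frequency the modes `f' ∓ imf`, multiplied by
`exp(±imx)`, change only through `q`. So for `|m|`, `|k|` large against `Q`, the eigenfunction is
nearly `sin(mx)` on the barrier and nearly a multiple of `exp(ikx)` after it
(`dirichlet_solution_bounds`, `decaying_solution_bounds`).

Matching at `R` compares two amplitudes: with `E = exp(imR)` and `P = f'(0)`, `E(f' - imf) ≈ P` and
`E(f' + imf) ≈ E²P`, while the tail makes `f' - ikf` small against `f' + ikf`. If `m` and `k` form
an acute angle, then `k ≈ m`, so `P` would have to be small against an amplitude of size at most
about `|P|`: impossible. Outside the strip such roots always exist, which gives (a).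

In the strip the angle may be obtuse. Then `k ≈ -m`, the modes swap roles, and the matching only
forces `|E|² = exp(-2R Im m) = O(1/|m|)`. But `Im m` is at most about `γ/(√2|m|)`, so if `|m| >
5γR/log R` then `|E|²` is at least `R^(-3/10)`, which exceeds `O(log R/R)` for large `R`. This gives
(b). -/

open Filter Topology

/-! ### First-order modes and Duhamel's formula -/

/-- Integration by parts for the primitive of an integrable function against a `C¹` function. -/
theorem integral_mul_primitive {e e' G : ℝ → ℂ} {a b : ℝ} (hab : a ≤ b)
    (he : ∀ t, HasDerivAt e (e' t) t) (he' : Continuous e')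
    (hG : IntervalIntegrable G volume a b) :
    ∫ t in a..b, e' t * ∫ s in a..t, G s = e b * (∫ t in a..b, G t) - ∫ t in a..b, e t * G t := by
  have hG' : IntegrableOn G (Ioc a b) := (intervalIntegrable_iff_integrableOn_Ioc_of_le hab).1 hG
  -- Fubini on the triangle `s ≤ t`: the primitive of a merely integrable `G` need not be
  -- differentiable everywhere.
  have hint : Integrable (fun x : ℝ × ℝ => {x : ℝ × ℝ | x.2 ≤ x.1}.indicator
      (fun x => e' x.1 * G x.2) x)
      ((volume.restrict (Ioc a b)).prod (volume.restrict (Ioc a b))) :=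
    (Integrable.mul_prod (((intervalIntegrable_iff_integrableOn_Ioc_of_le hab).1
      (he'.intervalIntegrable a b))) hG').indicator (measurableSet_le measurable_snd measurable_fst)
  have hswap := integral_integral_swap (f := fun t s => {x : ℝ × ℝ | x.2 ≤ x.1}.indicator
      (fun x => e' x.1 * G x.2) (t, s)) hint
  have hl : ∀ t ∈ Ioc a b, ∫ s in Ioc a b, {x : ℝ × ℝ | x.2 ≤ x.1}.indicator
      (fun x => e' x.1 * G x.2) (t, s) = e' t * ∫ s in a..t, G s := by
    intro t ht
    have h1 : ∀ s, {x : ℝ × ℝ | x.2 ≤ x.1}.indicator (fun x => e' x.1 * G x.2) (t, s)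
        = (Iic t).indicator (fun s => e' t * G s) s := by
      intro s
      simp only [indicator_apply, mem_Iic, mem_ofPred_eq]
    simp_rw [h1]
    rw [setIntegral_indicator measurableSet_Iic, Ioc_inter_Iic, min_eq_right ht.2,
      integral_const_mul, intervalIntegral.integral_of_le ht.1.le]
  have hr : ∀ s ∈ Ioc a b, ∫ t in Ioc a b, {x : ℝ × ℝ | x.2 ≤ x.1}.indicator
      (fun x => e' x.1 * G x.2) (t, s) = e b * G s - e s * G s := by
    intro s hs
    have h1 : ∀ t, {x : ℝ × ℝ | x.2 ≤ x.1}.indicator (fun x => e' x.1 * G x.2) (t, s)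
        = (Ici s).indicator (fun t => e' t * G s) t := by
      intro t
      simp only [indicator_apply, mem_Ici, mem_ofPred_eq]
    simp_rw [h1]
    have h2 : Ioc a b ∩ Ici s = Icc s b := by
      ext t; simp only [mem_inter_iff, mem_Ioc, mem_Ici, mem_Icc]
      constructor
      · rintro ⟨h, h'⟩; exact ⟨h', h.2⟩
      · rintro ⟨h, h'⟩; exact ⟨⟨hs.1.trans_le h, h'⟩, h⟩
    rw [setIntegral_indicator measurableSet_Ici, h2, integral_Icc_eq_integral_Ioc,
      ← intervalIntegral.integral_of_le hs.2, intervalIntegral.integral_mul_const,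
      intervalIntegral.integral_eq_sub_of_hasDerivAt (fun t _ => he t)
        (he'.intervalIntegrable _ _), sub_mul]
  have hec : Continuous e := continuous_iff_continuousAt.2 fun t => (he t).continuousAt
  rw [setIntegral_congr_fun measurableSet_Ioc hl, setIntegral_congr_fun measurableSet_Ioc hr,
    ← intervalIntegral.integral_of_le hab, ← intervalIntegral.integral_of_le hab] at hswap
  rw [hswap, intervalIntegral.integral_sub (hG.const_mul _) (hG.continuousOn_mul hec.continuousOn),
    intervalIntegral.integral_const_mul]

theorem HasACDeriv.intervalIntegrable' {f g : ℝ → ℂ} (h : HasACDeriv f g) {a b : ℝ}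
    (ha : 0 ≤ a) (hb : 0 ≤ b) : IntervalIntegrable g volume a b :=
  (h.1 a ha).symm.trans (h.1 b hb)

theorem HasACDeriv.sub_eq_integral {f g : ℝ → ℂ} (h : HasACDeriv f g) {a b : ℝ}
    (ha : 0 ≤ a) (hb : 0 ≤ b) : f b - f a = ∫ t in a..b, g t := by
  rw [h.2 a ha, h.2 b hb, ← intervalIntegral.integral_interval_sub_left (h.1 b hb) (h.1 a ha)]
  ring

/-- Duhamel's formula for the first-order equation `F' = H - c F`. -/
theorem HasACDeriv.duhamel {F G H : ℝ → ℂ} (h : HasACDeriv F G) (c : ℂ) {a b : ℝ}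
    (ha : 0 ≤ a) (hab : a ≤ b)
    (hG : ∀ᵐ t : ℝ, t ∈ Ioc a b → G t = H t - c * F t) :
    Complex.exp (c * b) * F b - Complex.exp (c * a) * F a
      = ∫ t in a..b, Complex.exp (c * t) * H t := by
  have hI := h.intervalIntegrable' ha (ha.trans hab)
  have he : ∀ t : ℝ, HasDerivAt (fun t : ℝ => Complex.exp (c * t)) (Complex.exp (c * t) * c) t := by
    intro t
    have h1 : HasDerivAt (fun t : ℝ => c * (t : ℂ)) c t := by
      simpa using (Complex.ofRealCLM.hasDerivAt (x := t)).const_mul c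
    exact h1.cexp
  have hec : Continuous fun t : ℝ => Complex.exp (c * t) := by fun_prop
  have hec' : Continuous fun t : ℝ => Complex.exp (c * t) * c := by fun_prop
  have key := integral_mul_primitive hab he hec' hI
  have hFc : ContinuousOn F (uIcc a b) := by
    rw [uIcc_of_le hab]
    exact h.continuousOn.mono fun x hx => ha.trans hx.1
  have h1 : ∫ t in a..b, Complex.exp (c * t) * c * (∫ s in a..t, G s)
      = (∫ t in a..b, Complex.exp (c * t) * c * F t)
        - (Complex.exp (c * b) - Complex.exp (c * a)) * F a := by
    rw [← intervalIntegral.integral_eq_sub_of_hasDerivAt (fun t _ => he t)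
      (hec'.intervalIntegrable a b), ← intervalIntegral.integral_mul_const,
      ← intervalIntegral.integral_sub]
    · refine intervalIntegral.integral_congr fun t ht => ?_
      rw [uIcc_of_le hab] at ht
      rw [← h.sub_eq_integral ha (ha.trans ht.1)]
      ring
    · exact (hec'.continuousOn.mul hFc).intervalIntegrable
    · exact (hec'.mul continuous_const).intervalIntegrable _ _
  have h2 : ∫ t in a..b, Complex.exp (c * t) * H t
      = (∫ t in a..b, Complex.exp (c * t) * G t) + ∫ t in a..b, Complex.exp (c * t) * c * F t := by
    rw [← intervalIntegral.integral_add (hI.continuousOn_mul hec.continuousOn)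
      (show IntervalIntegrable (fun t : ℝ => Complex.exp (c * t) * c * F t) volume a b from
        (hec'.continuousOn.mul hFc).intervalIntegrable)]
    refine intervalIntegral.integral_congr_ae ?_
    filter_upwards [hG] with t ht ht'
    rw [uIoc_of_le hab] at ht'
    rw [ht ht']
    ring
  rw [h1, ← h.sub_eq_integral ha (ha.trans hab)] at key
  rw [h2]
  linear_combination -key

/-- The mode `f' - i m f` of a solution of `f'' = (q - m²) f` satisfies an integrated first-order
equation; consequently its variation is controlled by `‖q‖₁`. -/
theorem norm_mode_sub_le {f p r q : ℝ → ℂ} (hf : HasACDeriv f p) (hp : HasACDeriv p r)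
    (hq : IntegrableOn q (Ioi 0)) (m : ℂ) {a b K : ℝ} (ha : 0 ≤ a) (hab : a ≤ b)
    (hr : ∀ᵐ t : ℝ, t ∈ Ioc a b → r t = (q t - m ^ 2) * f t)
    (hK : ∀ t ∈ Icc a b, ‖Complex.exp (Complex.I * m * t)‖ * ‖f t‖ ≤ K) :
    ‖Complex.exp (Complex.I * m * b) * (p b - Complex.I * m * f b)
      - Complex.exp (Complex.I * m * a) * (p a - Complex.I * m * f a)‖
      ≤ K * ∫ t in Ioi (0 : ℝ), ‖q t‖ := by
  have hF : HasACDeriv (p + (-(Complex.I * m)) • f) (r + (-(Complex.I * m)) • p) :=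
    hp.add (hf.smul _)
  -- `(d/dx + im)(f' - imf) = f'' + m²f = qf`, so `m²` drops out of the source term.
  have key := hF.duhamel (H := fun t => q t * f t) (Complex.I * m) ha hab (by
    filter_upwards [hr] with t ht ht'
    simp only [Pi.add_apply, Pi.smul_apply, smul_eq_mul, ht ht']
    linear_combination (-m ^ 2 * f t) * Complex.I_sq)
  have e : ∀ t, (p + (-(Complex.I * m)) • f) t = p t - Complex.I * m * f t := by
    intro t; simp only [Pi.add_apply, Pi.smul_apply, smul_eq_mul]; ring
  rw [e, e] at key
  rw [key]
  have hsub : Ioc a b ⊆ Ioi 0 := fun t ht => ha.trans_lt ht.1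
  have hqi : IntegrableOn (fun t => ‖q t‖) (Ioc a b) :=
    IntegrableOn.mono_set (t := Ioi 0) hq.norm hsub
  have hK0 : 0 ≤ K := (by positivity : (0:ℝ) ≤ _).trans (hK a ⟨le_rfl, hab⟩)
  calc ‖∫ t in a..b, Complex.exp (Complex.I * m * t) * (q t * f t)‖
      ≤ ∫ t in a..b, K * ‖q t‖ := by
        refine intervalIntegral.norm_integral_le_of_norm_le hab ?_
          (((intervalIntegrable_iff_integrableOn_Ioc_of_le hab).2 hqi).const_mul K)
        refine Filter.Eventually.of_forall fun t ht => ?_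
        rw [norm_mul, norm_mul]
        have := mul_le_mul_of_nonneg_right (hK t ⟨ht.1.le, ht.2⟩) (norm_nonneg (q t))
        linarith
    _ = K * ∫ t in Ioc a b, ‖q t‖ := by
        rw [intervalIntegral.integral_const_mul, intervalIntegral.integral_of_le hab]
    _ ≤ _ := by
        refine mul_le_mul_of_nonneg_left ?_ hK0
        exact setIntegral_mono_set hq.norm (Filter.Eventually.of_forall fun t => norm_nonneg _)
          hsub.eventuallyLE

theorem norm_cexp_I_mul (m : ℂ) (t : ℝ) :
    ‖Complex.exp (Complex.I * m * t)‖ = Real.exp (-(m.im * t)) := by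
  rw [Complex.norm_exp]
  congr 1
  simp

theorem norm_two_I_mul (m z : ℂ) : ‖2 * Complex.I * m * z‖ = 2 * (‖m‖ * ‖z‖) := by
  rw [norm_mul, norm_mul, norm_mul, Complex.norm_I, Complex.norm_ofNat]
  ring

/-! ### Perturbation estimates on the barrier and beyond it -/

/-- Behaviour at the end of `[0, b]` of a solution of `f'' = (q - m²) f` with `f(0) = 0`. -/
theorem dirichlet_solution_bounds {f p r q : ℝ → ℂ} (hf : HasACDeriv f p) (hp : HasACDeriv p r)
    (hq : IntegrableOn q (Ioi 0)) {m : ℂ} {b : ℝ} (hm : 0 ≤ m.im) (hm0 : 0 < ‖m‖)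
    (hmQ : 2 * ∫ t in Ioi (0 : ℝ), ‖q t‖ ≤ ‖m‖) (hb : 0 ≤ b) (h0 : f 0 = 0)
    (hr : ∀ᵐ t : ℝ, t ∈ Ioc 0 b → r t = (q t - m ^ 2) * f t) :
    ‖Complex.exp (Complex.I * m * b) * (p b - Complex.I * m * f b) - p 0‖
        ≤ 2 * ‖p 0‖ / ‖m‖ * ∫ t in Ioi (0 : ℝ), ‖q t‖ ∧
    ‖Complex.exp (Complex.I * m * b) * (p b + Complex.I * m * f b)
        - Complex.exp (Complex.I * m * b) ^ 2 * p 0‖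
        ≤ 2 * ‖p 0‖ / ‖m‖ * ∫ t in Ioi (0 : ℝ), ‖q t‖ ∧
    ∀ x ∈ Icc 0 b, ‖Complex.exp (Complex.I * m * x)‖ * ‖f x‖ ≤ 2 * ‖p 0‖ / ‖m‖ := by
  set Q := ∫ t in Ioi (0 : ℝ), ‖q t‖ with hQ
  have hQ0 : 0 ≤ Q := integral_nonneg fun t => norm_nonneg _
  have hcont : ContinuousOn (fun t : ℝ => ‖Complex.exp (Complex.I * m * t)‖ * ‖f t‖) (Icc 0 b) := by
    refine ContinuousOn.mul (by fun_prop) ?_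
    exact (hf.continuousOn.mono fun x hx => hx.1).norm
  -- The mode estimates involve the unknown maximum `M` of the weighted `|f|`. It is bounded
  -- afterwards by evaluating them at the maximum point.
  obtain ⟨x₀, hx₀, hmax⟩ := isCompact_Icc.exists_isMaxOn (nonempty_Icc.2 hb) hcont
  set M := ‖Complex.exp (Complex.I * m * x₀)‖ * ‖f x₀‖ with hM
  have hMle : ∀ t ∈ Icc 0 b, ‖Complex.exp (Complex.I * m * t)‖ * ‖f t‖ ≤ M := fun t ht => hmax ht
  have hminus : ∀ x ∈ Icc 0 b,
      ‖Complex.exp (Complex.I * m * x) * (p x - Complex.I * m * f x) - p 0‖ ≤ M * Q := by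
    intro x hx
    have := norm_mode_sub_le hf hp hq m le_rfl hx.1 (K := M)
      (hr.mono fun t ht ht' => ht ⟨ht'.1, ht'.2.trans hx.2⟩)
      (fun t ht => hMle t ⟨ht.1, ht.2.trans hx.2⟩)
    simpa [h0] using this
  have hplus : ∀ x ∈ Icc 0 b,
      ‖Complex.exp (Complex.I * m * x) * (p x + Complex.I * m * f x)
        - Complex.exp (Complex.I * m * x) ^ 2 * p 0‖ ≤ M * Q := by
    intro x hx
    have hinv : Complex.exp (Complex.I * m * x) * Complex.exp (Complex.I * (-m) * x) = 1 := by
      rw [← Complex.exp_add]; simp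
    have := norm_mode_sub_le hf hp hq (-m) le_rfl hx.1
      -- The weight `|exp(-imt)|` exceeds `|exp(imt)|` by `exp(2t Im m)`. This loss is cancelled
      -- exactly by the factor `exp(imx)²` restored below.
      (K := M * Real.exp (2 * (m.im * x)))
      (hr.mono fun t ht ht' => by rw [ht ⟨ht'.1, ht'.2.trans hx.2⟩, neg_sq])
      (fun t ht => by
        have h1 := hMle t ⟨ht.1, ht.2.trans hx.2⟩
        rw [norm_cexp_I_mul] at h1 ⊢
        have h2 : Real.exp (-((-m).im * t)) = Real.exp (-(m.im * t)) * Real.exp (2 * (m.im * t)) := by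
          rw [← Real.exp_add]; congr 1; simp; ring
        have h3 : Real.exp (2 * (m.im * t)) ≤ Real.exp (2 * (m.im * x)) := by
          have := mul_le_mul_of_nonneg_left ht.2 hm
          exact Real.exp_le_exp.2 (by linarith)
        rw [h2]
        calc _ = (Real.exp (-(m.im * t)) * ‖f t‖) * Real.exp (2 * (m.im * t)) := by ring
          _ ≤ M * Real.exp (2 * (m.im * x)) := by
            refine mul_le_mul h1 h3 (Real.exp_pos _).le ?_
            exact (by positivity : (0:ℝ) ≤ _).trans h1)
    have hE : ‖Complex.exp (Complex.I * m * x)‖ ^ 2 * Real.exp (2 * (m.im * x)) = 1 := by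
      rw [norm_cexp_I_mul, ← Real.exp_nat_mul, ← Real.exp_add]; simp
    have h4 : Complex.exp (Complex.I * m * x) * (p x + Complex.I * m * f x)
        - Complex.exp (Complex.I * m * x) ^ 2 * p 0
        = Complex.exp (Complex.I * m * x) ^ 2 * (Complex.exp (Complex.I * (-m) * x)
          * (p x - Complex.I * (-m) * f x) - Complex.exp (Complex.I * (-m) * (0:ℝ))
          * (p 0 - Complex.I * (-m) * f 0)) := by
      rw [h0]
      simp only [Complex.ofReal_zero, mul_zero, Complex.exp_zero, sub_zero, one_mul]
      linear_combination (-Complex.exp (Complex.I * m * x) * (p x + Complex.I * m * f x)) * hinv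
    rw [h4, norm_mul, norm_pow]
    calc _ ≤ ‖Complex.exp (Complex.I * m * x)‖ ^ 2 * (M * Real.exp (2 * (m.im * x)) * Q) := by gcongr
      _ = ‖Complex.exp (Complex.I * m * x)‖ ^ 2 * Real.exp (2 * (m.im * x)) * (M * Q) := by ring
      _ = M * Q := by rw [hE, one_mul]
  -- The two modes differ by `2imf`, so `2|m|M ≤ 2MQ + 2|f'(0)|`; since `2Q ≤ |m|`, the term with
  -- `M` is absorbed.
  have hM2 : ‖m‖ * M ≤ 2 * ‖p 0‖ := by
    have h1 := hminus x₀ hx₀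
    have h2 := hplus x₀ hx₀
    have hE1 : ‖Complex.exp (Complex.I * m * x₀)‖ ≤ 1 := by
      rw [norm_cexp_I_mul]
      exact Real.exp_le_one_iff.2 (by have := mul_nonneg hm hx₀.1; linarith)
    set E := Complex.exp (Complex.I * m * x₀)
    have h3 : 2 * Complex.I * m * (E * f x₀) = (E * (p x₀ + Complex.I * m * f x₀) - E ^ 2 * p 0)
        - (E * (p x₀ - Complex.I * m * f x₀) - p 0) + (E ^ 2 * p 0 - p 0) := by ring
    have h4 := congrArg norm h3
    rw [norm_two_I_mul, norm_mul] at h4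
    have h5 := (norm_add_le ((E * (p x₀ + Complex.I * m * f x₀) - E ^ 2 * p 0)
        - (E * (p x₀ - Complex.I * m * f x₀) - p 0)) (E ^ 2 * p 0 - p 0)).trans
        (add_le_add (norm_sub_le _ _) (norm_sub_le _ _))
    have h6 : ‖E ^ 2 * p 0‖ ≤ ‖p 0‖ := by
      rw [norm_mul, norm_pow]
      exact mul_le_of_le_one_left (norm_nonneg _) (pow_le_one₀ (norm_nonneg _) hE1)
    have hM0 : 0 ≤ M := by positivity
    have h7 := mul_le_mul_of_nonneg_right hmQ hM0
    rw [← h4] at h5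
    nlinarith
  have hM3 : M ≤ 2 * ‖p 0‖ / ‖m‖ := by
    rw [le_div_iff₀ hm0]; linarith
  refine ⟨(hminus b ⟨hb, le_rfl⟩).trans ?_, (hplus b ⟨hb, le_rfl⟩).trans ?_,
    fun x hx => (hMle x hx).trans hM3⟩ <;> gcongr

/-- A solution of `f'' = (q - k²) f` on `[R,∞)` that tends to `0` together with its derivative is
close to a multiple of `exp(ikx)`. -/
theorem decaying_solution_bounds {f p r q : ℝ → ℂ} (hf : HasACDeriv f p) (hp : HasACDeriv p r)
    (hq : IntegrableOn q (Ioi 0)) {k : ℂ} {R : ℝ} (hk : 0 ≤ k.im) (hk0 : 0 < ‖k‖)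
    (hkQ : 2 * ∫ t in Ioi (0 : ℝ), ‖q t‖ ≤ ‖k‖) (hR : 0 ≤ R)
    (hr : ∀ᵐ t : ℝ, R < t → r t = (q t - k ^ 2) * f t)
    (hf0 : Tendsto (fun n : ℕ => f n) atTop (𝓝 0))
    (hp0 : Tendsto (fun n : ℕ => p n) atTop (𝓝 0)) :
    (∀ x, R ≤ x → ‖f x‖ ≤ ‖p R + Complex.I * k * f R‖ / ‖k‖) ∧
    ‖p R - Complex.I * k * f R‖
      ≤ (∫ t in Ioi (0 : ℝ), ‖q t‖) / ‖k‖ * ‖p R + Complex.I * k * f R‖ := by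
  set Q := ∫ t in Ioi (0 : ℝ), ‖q t‖ with hQ
  have hQ0 : 0 ≤ Q := integral_nonneg fun t => norm_nonneg _
  set A := ‖p R + Complex.I * k * f R‖ with hA
  -- Everything is estimated on `[R,n]` with boundary error `ε n`, which disappears as `n → ∞`. The
  -- mode `f' - ikf` is integrated back from `n` and `f' + ikf` forward from `R`, so that in both
  -- cases the exponential weight is largest at `x` and can be divided out.
  set ε : ℕ → ℝ := fun n => ‖p n - Complex.I * k * f n‖ with hε
  have hε0 : Tendsto ε atTop (𝓝 0) := by
    have := (hp0.sub (hf0.const_mul (Complex.I * k))).norm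
    simpa using this
  have key : ∀ n : ℕ, R ≤ n → (∀ x ∈ Icc R n, ‖f x‖ ≤ (A + ε n) / ‖k‖) ∧
      ‖p R - Complex.I * k * f R‖ ≤ ε n + (A + ε n) / ‖k‖ * Q := by
    intro n hn
    have hcont : ContinuousOn (fun t : ℝ => ‖f t‖) (Icc R n) :=
      (hf.continuousOn.mono fun x hx => hR.trans hx.1).norm
    obtain ⟨x₀, hx₀, hmax⟩ := isCompact_Icc.exists_isMaxOn (nonempty_Icc.2 hn) hcont
    set M := ‖f x₀‖ with hM
    have hMle : ∀ t ∈ Icc R n, ‖f t‖ ≤ M := fun t ht => hmax ht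
    have hminus : ∀ x ∈ Icc R n, ‖p x - Complex.I * k * f x‖ ≤ ε n + M * Q := by
      intro x hx
      have h1 := norm_mode_sub_le hf hp hq k (hR.trans hx.1) hx.2
        (K := ‖Complex.exp (Complex.I * k * x)‖ * M)
        (hr.mono fun t ht ht' => ht (hx.1.trans_lt ht'.1))
        (fun t ht => by
          refine mul_le_mul ?_ (hMle t ⟨hx.1.trans ht.1, ht.2⟩) (norm_nonneg _) (norm_nonneg _)
          rw [norm_cexp_I_mul, norm_cexp_I_mul]
          exact Real.exp_le_exp.2 (neg_le_neg (mul_le_mul_of_nonneg_left ht.1 hk)))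
      have h2 : ‖Complex.exp (Complex.I * k * (n:ℝ))‖ ≤ ‖Complex.exp (Complex.I * k * x)‖ := by
        rw [norm_cexp_I_mul, norm_cexp_I_mul]
        exact Real.exp_le_exp.2 (neg_le_neg (mul_le_mul_of_nonneg_left hx.2 hk))
      have h3 : 0 < ‖Complex.exp (Complex.I * k * x)‖ := norm_pos_iff.2 (Complex.exp_ne_zero _)
      have h4 := norm_sub_norm_le (Complex.exp (Complex.I * k * x) * (p x - Complex.I * k * f x))
        (Complex.exp (Complex.I * k * (n:ℝ)) * (p n - Complex.I * k * f n))
      rw [norm_sub_rev, norm_mul, norm_mul] at h4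
      have h5 := mul_le_mul_of_nonneg_right h2 (norm_nonneg (p n - Complex.I * k * f n))
      refine le_of_mul_le_mul_left ?_ h3
      calc _ ≤ ‖Complex.exp (Complex.I * k * x)‖ * ‖p n - Complex.I * k * f n‖
            + ‖Complex.exp (Complex.I * k * x)‖ * M * Q := by linarith
        _ = _ := by rw [hε]; ring
    have hplus : ∀ x ∈ Icc R n, ‖p x + Complex.I * k * f x‖ ≤ A + M * Q := by
      intro x hx
      have h1 := norm_mode_sub_le hf hp hq (-k) hR hx.1
        (K := ‖Complex.exp (Complex.I * (-k) * x)‖ * M)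
        (hr.mono fun t ht ht' => by rw [ht ht'.1, neg_sq])
        (fun t ht => by
          refine mul_le_mul ?_ (hMle t ⟨ht.1, ht.2.trans hx.2⟩) (norm_nonneg _) (norm_nonneg _)
          rw [norm_cexp_I_mul, norm_cexp_I_mul, Complex.neg_im]
          have := mul_le_mul_of_nonneg_left ht.2 hk
          exact Real.exp_le_exp.2 (by linarith))
      have h2 : ‖Complex.exp (Complex.I * (-k) * R)‖ ≤ ‖Complex.exp (Complex.I * (-k) * x)‖ := by
        rw [norm_cexp_I_mul, norm_cexp_I_mul, Complex.neg_im]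
        have := mul_le_mul_of_nonneg_left hx.1 hk
        exact Real.exp_le_exp.2 (by linarith)
      have h3 : 0 < ‖Complex.exp (Complex.I * (-k) * x)‖ := norm_pos_iff.2 (Complex.exp_ne_zero _)
      have e : ∀ y, p y - Complex.I * (-k) * f y = p y + Complex.I * k * f y := fun y => by ring
      rw [e, e] at h1
      have h4 := norm_sub_norm_le (Complex.exp (Complex.I * (-k) * x) * (p x + Complex.I * k * f x))
        (Complex.exp (Complex.I * (-k) * R) * (p R + Complex.I * k * f R))
      rw [norm_mul, norm_mul] at h4
      have h5 := mul_le_mul_of_nonneg_right h2 (norm_nonneg (p R + Complex.I * k * f R))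
      refine le_of_mul_le_mul_left ?_ h3
      calc _ ≤ ‖Complex.exp (Complex.I * (-k) * x)‖ * ‖p R + Complex.I * k * f R‖
            + ‖Complex.exp (Complex.I * (-k) * x)‖ * M * Q := by linarith
        _ = _ := by rw [hA]; ring
    have hM2 : ‖k‖ * M ≤ A + ε n := by
      have h1 := hminus x₀ hx₀
      have h2 := hplus x₀ hx₀
      have h3 : 2 * Complex.I * k * f x₀
          = (p x₀ + Complex.I * k * f x₀) - (p x₀ - Complex.I * k * f x₀) := by ring
      have h4 := congrArg norm h3
      rw [norm_two_I_mul] at h4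
      have h5 := norm_sub_le (p x₀ + Complex.I * k * f x₀) (p x₀ - Complex.I * k * f x₀)
      have hM0 : 0 ≤ M := norm_nonneg _
      have h7 := mul_le_mul_of_nonneg_right hkQ hM0
      rw [← h4] at h5
      nlinarith
    have hM3 : M ≤ (A + ε n) / ‖k‖ := by
      rw [le_div_iff₀ hk0]; linarith
    refine ⟨fun x hx => (hMle x hx).trans hM3, (hminus R ⟨le_rfl, hn⟩).trans ?_⟩
    gcongr
  have hlim : Tendsto (fun n => (A + ε n) / ‖k‖) atTop (𝓝 (A / ‖k‖)) := by
    simpa using (hε0.const_add A).div_const ‖k‖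
  constructor
  · intro x hx
    refine ge_of_tendsto hlim ?_
    obtain ⟨N, hN⟩ := exists_nat_ge x
    filter_upwards [eventually_ge_atTop N] with n hn
    have hn' : x ≤ n := hN.trans (by exact_mod_cast hn)
    exact (key n (hx.trans hn')).1 x ⟨hx, hn'⟩
  · have hlim2 : Tendsto (fun n => ε n + (A + ε n) / ‖k‖ * Q) atTop (𝓝 (Q / ‖k‖ * A)) := by
      have := hε0.add (hlim.mul_const Q)
      rw [zero_add] at this
      convert this using 2
      ring
    refine ge_of_tendsto hlim2 ?_
    obtain ⟨N, hN⟩ := exists_nat_ge R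
    filter_upwards [eventually_ge_atTop N] with n hn
    exact (key n (hN.trans (by exact_mod_cast hn))).2

/-! ### Decay of square-integrable solutions -/

/-- The integrals of an integrable function over `[n, n+1]` tend to `0`. -/
theorem tendsto_integral_unit_interval {g : ℝ → ℝ} (hg : IntegrableOn g (Ioi 0)) :
    Tendsto (fun n : ℕ => ∫ t in (n : ℝ)..(n + 1), g t) atTop (𝓝 0) := by
  have h1 := intervalIntegral_tendsto_integral_Ioi 0 hg
    (tendsto_natCast_atTop_atTop (R := ℝ))
  have h2 := h1.comp (tendsto_add_atTop_nat 1)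
  have h3 := h2.sub h1
  rw [sub_self] at h3
  have hI : ∀ x : ℝ, 0 ≤ x → IntervalIntegrable g volume 0 x := fun x hx =>
    (intervalIntegrable_iff_integrableOn_Ioc_of_le hx).2 (hg.mono_set fun t ht => ht.1)
  refine h3.congr fun n => ?_
  simp only [Function.comp_apply, Nat.cast_add, Nat.cast_one]
  exact intervalIntegral.integral_interval_sub_left (hI _ (by positivity)) (hI _ (by positivity))

/-- On `[0,1]` the functions `4 - 6s` and `12s - 6` are biorthogonal to `1` and `s`, so they read
off the coefficients of a linear function. Their sup norms, 4 and 6, are the constants in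
`unit_interval_bounds`. -/
theorem integral_linear_test (a : ℝ) (u v : ℂ) :
    (∫ t in a..(a + 1), (4 - 6 * ((t : ℂ) - a)) * (u + ((t : ℂ) - a) * v) = u) ∧
    (∫ t in a..(a + 1), (12 * ((t : ℂ) - a) - 6) * (u + ((t : ℂ) - a) * v) = v) := by
  have hd : ∀ t : ℝ, HasDerivAt (fun t : ℝ => (t : ℂ) - a) 1 t := fun t =>
    (Complex.ofRealCLM.hasDerivAt (x := t)).sub_const _
  constructor
  · rw [intervalIntegral.integral_eq_sub_of_hasDerivAt (f := fun t : ℝ =>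
      4 * u * ((t : ℂ) - a) + (2 * v - 3 * u) * ((t : ℂ) - a) ^ 2 - 2 * v * ((t : ℂ) - a) ^ 3)]
    · push_cast; ring
    · intro t _
      refine ((((hd t).const_mul (4 * u)).add (((hd t).pow 2).const_mul (2 * v - 3 * u))).sub
        (((hd t).pow 3).const_mul (2 * v))).congr_deriv ?_
      norm_num; ring
    · exact Continuous.intervalIntegrable (by fun_prop) _ _
  · rw [intervalIntegral.integral_eq_sub_of_hasDerivAt (f := fun t : ℝ =>
      -6 * u * ((t : ℂ) - a) + (6 * u - 3 * v) * ((t : ℂ) - a) ^ 2 + 4 * v * ((t : ℂ) - a) ^ 3)]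
    · push_cast; ring
    · intro t _
      refine ((((hd t).const_mul (-6 * u)).add (((hd t).pow 2).const_mul (6 * u - 3 * v))).add
        (((hd t).pow 3).const_mul (4 * v))).congr_deriv ?_
      norm_num; ring
    · exact Continuous.intervalIntegrable (by fun_prop) _ _

/-- Interpolation on a unit interval: the values of `f` and `f'` are controlled by the `L¹` norms
of `f` and `f''`. -/
theorem unit_interval_bounds {f p r : ℝ → ℂ} (hf : HasACDeriv f p) (hp : HasACDeriv p r)
    {a A : ℝ} (ha : 0 ≤ a) (hA : ∫ t in a..(a + 1), ‖r t‖ ≤ A) :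
    ‖f a‖ ≤ 4 * ((∫ t in a..(a + 1), ‖f t‖) + A) ∧
    ‖p a‖ ≤ 6 * ((∫ t in a..(a + 1), ‖f t‖) + A) ∧
    ∀ x ∈ Icc a (a + 1), ‖f x‖ ≤ 11 * ((∫ t in a..(a + 1), ‖f t‖) + A) := by
  have haa : a ≤ a + 1 := by linarith
  have hI := (hp.intervalIntegrable' ha (ha.trans haa)).norm
  have hpx : ∀ x ∈ Icc a (a + 1), ‖p x - p a‖ ≤ A := by
    intro x hx
    rw [hp.sub_eq_integral ha (ha.trans hx.1)]
    refine (intervalIntegral.norm_integral_le_integral_norm hx.1).trans (le_trans ?_ hA)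
    exact intervalIntegral.integral_mono_interval le_rfl hx.1 hx.2
      (Eventually.of_forall fun t => norm_nonneg _) hI
  have hA0 : 0 ≤ A := (norm_nonneg _).trans (hpx a ⟨le_rfl, haa⟩)
  -- `f` stays within `A` of its tangent line at `a`, so testing that line against bounded functions
  -- costs only `‖f‖₁ + A`.
  have hfx : ∀ x ∈ Icc a (a + 1), ‖f x - (f a + ((x : ℂ) - a) * p a)‖ ≤ A := by
    intro x hx
    have h1 : f x - (f a + ((x : ℂ) - a) * p a) = ∫ t in a..x, (p t - p a) := by
      rw [intervalIntegral.integral_sub (hf.intervalIntegrable' ha (ha.trans hx.1))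
        intervalIntegrable_const, ← hf.sub_eq_integral ha (ha.trans hx.1),
        intervalIntegral.integral_const, Complex.real_smul]
      push_cast; ring
    rw [h1]
    refine (intervalIntegral.norm_integral_le_of_norm_le_const (C := A) ?_).trans ?_
    · intro t ht
      rw [uIoc_of_le hx.1] at ht
      exact hpx t ⟨ht.1.le, ht.2.trans hx.2⟩
    · rw [abs_of_nonneg (by linarith [hx.1])]
      exact mul_le_of_le_one_right hA0 (by linarith [hx.2])
  have hfc : ContinuousOn f (uIcc a (a + 1)) := by
    rw [uIcc_of_le haa]
    exact hf.continuousOn.mono fun x hx => ha.trans hx.1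
  have hfi : IntervalIntegrable (fun t => ‖f t‖) volume a (a + 1) := hfc.norm.intervalIntegrable
  have test : ∀ (φ : ℝ → ℂ) (C : ℝ), (∀ t ∈ Icc a (a + 1), ‖φ t‖ ≤ C) →
      ‖∫ t in a..(a + 1), φ t * (f a + ((t : ℂ) - a) * p a)‖
        ≤ C * ((∫ t in a..(a + 1), ‖f t‖) + A) := by
    intro φ C hφ
    have hC : 0 ≤ C := (norm_nonneg _).trans (hφ a ⟨le_rfl, haa⟩)
    have h1 : C * ((∫ t in a..(a + 1), ‖f t‖) + A) = ∫ t in a..(a + 1), C * (‖f t‖ + A) := by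
      rw [intervalIntegral.integral_const_mul, intervalIntegral.integral_add hfi
        intervalIntegrable_const, intervalIntegral.integral_const]
      simp
    rw [h1]
    refine intervalIntegral.norm_integral_le_of_norm_le haa
      (Eventually.of_forall fun t ht => ?_) ((hfi.add intervalIntegrable_const).const_mul C)
    have ht' : t ∈ Icc a (a + 1) := ⟨ht.1.le, ht.2⟩
    rw [norm_mul]
    refine mul_le_mul (hφ t ht') ?_ (norm_nonneg _) hC
    have h2 := norm_sub_norm_le (f a + ((t : ℂ) - a) * p a) (f t)
    rw [norm_sub_rev] at h2
    linarith [hfx t ht']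
  have h1 := test (fun t => 4 - 6 * ((t : ℂ) - a)) 4 (fun t ht => by
    have e : (4 - 6 * ((t : ℂ) - a)) = ((4 - 6 * (t - a) : ℝ) : ℂ) := by push_cast; ring
    rw [e, Complex.norm_real, Real.norm_eq_abs, abs_le]
    constructor <;> linarith [ht.1, ht.2])
  have h2 := test (fun t => 12 * ((t : ℂ) - a) - 6) 6 (fun t ht => by
    have e : (12 * ((t : ℂ) - a) - 6) = ((12 * (t - a) - 6 : ℝ) : ℂ) := by push_cast; ring
    rw [e, Complex.norm_real, Real.norm_eq_abs, abs_le]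
    constructor <;> linarith [ht.1, ht.2])
  rw [(integral_linear_test a (f a) (p a)).1] at h1
  rw [(integral_linear_test a (f a) (p a)).2] at h2
  refine ⟨h1, h2, fun x hx => ?_⟩
  -- 11 = 4 + 6 + 1: value at `a`, slope at `a`, deviation from the tangent line.
  have h3 := norm_sub_norm_le (f x) (f a + ((x : ℂ) - a) * p a)
  have h4 := norm_add_le (f a) (((x : ℂ) - a) * p a)
  have h5 : ‖((x : ℂ) - a) * p a‖ ≤ ‖p a‖ := by
    rw [norm_mul, ← Complex.ofReal_sub, Complex.norm_real, Real.norm_eq_abs,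
      abs_of_nonneg (by linarith [hx.1])]
    exact mul_le_of_le_one_left (norm_nonneg _) (by linarith [hx.2])
  have h6 : 0 ≤ ∫ t in a..(a + 1), ‖f t‖ :=
    intervalIntegral.integral_nonneg haa fun t _ => norm_nonneg _
  linarith [hfx x hx]

/-- A square-integrable solution of `f'' = (q - w) f` with `q ∈ L¹` tends to `0` along the integers,
together with its derivative. -/
theorem tendsto_zero_of_sq_integrable {f p r q : ℝ → ℂ} (hf : HasACDeriv f p)
    (hp : HasACDeriv p r) (hq : IntegrableOn q (Ioi 0)) {w : ℂ} {R : ℝ}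
    (hr : ∀ᵐ t : ℝ, R < t → r t = (q t - w) * f t)
    (hL2 : IntegrableOn (fun t => ‖f t‖ ^ 2) (Ioi 0)) :
    Tendsto (fun n : ℕ => f n) atTop (𝓝 0) ∧ Tendsto (fun n : ℕ => p n) atTop (𝓝 0) := by
  set L : ℕ → ℝ := fun n => ∫ t in (n : ℝ)..(n + 1), ‖f t‖ with hLdef
  set ε : ℕ → ℝ := fun n => ∫ t in (n : ℝ)..(n + 1), ‖q t‖ with hεdef
  have hn0 : ∀ n : ℕ, (0 : ℝ) ≤ n := fun n => Nat.cast_nonneg n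
  have hn1 : ∀ n : ℕ, (n : ℝ) ≤ n + 1 := fun n => by linarith
  have hε : Tendsto ε atTop (𝓝 0) := tendsto_integral_unit_interval hq.norm
  have hfc : ∀ n : ℕ, ContinuousOn f (uIcc (n : ℝ) (n + 1)) := fun n => by
    rw [uIcc_of_le (hn1 n)]
    exact hf.continuousOn.mono fun x hx => (hn0 n).trans hx.1
  have hL0 : ∀ n, 0 ≤ L n := fun n =>
    intervalIntegral.integral_nonneg (hn1 n) fun t _ => norm_nonneg _
  have hL : Tendsto L atTop (𝓝 0) := by
    have h1 := (tendsto_integral_unit_interval hL2).sqrt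
    rw [Real.sqrt_zero] at h1
    refine squeeze_zero hL0 (fun n => Real.le_sqrt_of_sq_le ?_) h1
    -- Cauchy–Schwarz on an interval of length one, by expanding `∫(|f| - L)² ≥ 0`.
    have h2 : 0 ≤ ∫ t in (n : ℝ)..(n + 1), (‖f t‖ ^ 2 - (2 * L n * ‖f t‖ - L n ^ 2)) :=
      intervalIntegral.integral_nonneg (hn1 n) fun t _ => by nlinarith [sq_nonneg (‖f t‖ - L n)]
    have i1 : IntervalIntegrable (fun t => ‖f t‖) volume (n : ℝ) (n + 1) :=
      (hfc n).norm.intervalIntegrable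
    have i2 : IntervalIntegrable (fun t => ‖f t‖ ^ 2) volume (n : ℝ) (n + 1) :=
      ((hfc n).norm.pow 2).intervalIntegrable
    rw [intervalIntegral.integral_sub i2 ((i1.const_mul _).sub intervalIntegrable_const),
      intervalIntegral.integral_sub (i1.const_mul _) intervalIntegrable_const,
      intervalIntegral.integral_const_mul, intervalIntegral.integral_const] at h2
    simp only [add_sub_cancel_left, one_smul] at h2
    change 0 ≤ _ - (2 * L n * L n - L n ^ 2) at h2
    linarith
  have key : ∀ᶠ n : ℕ in atTop, ‖f n‖ ≤ (22 * (1 + ‖w‖)) * L n ∧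
      ‖p n‖ ≤ 6 * ((1 + ‖w‖) * L n + 22 * (1 + ‖w‖) * L n) := by
    obtain ⟨N, hN⟩ := exists_nat_ge R
    -- With `ε < 1/22`, the bound `S ≤ 11(L + εS + |w|L)` has at most `S/2` to absorb and yields `S
    -- ≤ 22(1 + |w|)L`.
    filter_upwards [eventually_ge_atTop N, hε.eventually_lt_const (show (0:ℝ) < 1 / 22 by norm_num)]
      with n hn hεn
    have hRn : R ≤ n := hN.trans (by exact_mod_cast hn)
    have hfc' := hfc n
    rw [uIcc_of_le (hn1 n)] at hfc'
    obtain ⟨x₀, hx₀, hmax⟩ := isCompact_Icc.exists_isMaxOn (nonempty_Icc.2 (hn1 n)) hfc'.norm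
    set S := ‖f x₀‖ with hS
    have hSle : ∀ t ∈ Icc (n : ℝ) (n + 1), ‖f t‖ ≤ S := fun t ht => hmax ht
    have hqi : IntervalIntegrable (fun t => ‖q t‖) volume (n : ℝ) (n + 1) :=
      (intervalIntegrable_iff_integrableOn_Ioc_of_le (hn1 n)).2
        (IntegrableOn.mono_set (t := Ioi 0) hq.norm fun t ht => (hn0 n).trans_lt ht.1)
    have hfi : IntervalIntegrable (fun t => ‖f t‖) volume (n : ℝ) (n + 1) :=
      (hfc n).norm.intervalIntegrable
    have hA : ∫ t in (n : ℝ)..(n + 1), ‖r t‖ ≤ ε n * S + ‖w‖ * L n := by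
      have h1 : ε n * S + ‖w‖ * L n = ∫ t in (n : ℝ)..(n + 1), (‖q t‖ * S + ‖w‖ * ‖f t‖) := by
        rw [intervalIntegral.integral_add (hqi.mul_const _) (hfi.const_mul _),
          intervalIntegral.integral_mul_const, intervalIntegral.integral_const_mul]
      rw [h1]
      refine intervalIntegral.integral_mono_ae_restrict (hn1 n)
        (hp.intervalIntegrable' (hn0 n) ((hn0 n).trans (hn1 n))).norm
        ((hqi.mul_const _).add (hfi.const_mul _)) ?_
      rw [EventuallyLE, ← restrict_Ioc_eq_restrict_Icc, ae_restrict_iff' measurableSet_Ioc]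
      filter_upwards [hr] with t ht ht'
      rw [ht (hRn.trans_lt ht'.1), norm_mul]
      calc _ ≤ (‖q t‖ + ‖w‖) * ‖f t‖ :=
            mul_le_mul_of_nonneg_right (norm_sub_le _ _) (norm_nonneg _)
        _ ≤ ‖q t‖ * S + ‖w‖ * ‖f t‖ := by
            have := mul_le_mul_of_nonneg_left (hSle t ⟨ht'.1.le, ht'.2⟩) (norm_nonneg (q t))
            linarith
    obtain ⟨-, b2, b3⟩ := unit_interval_bounds hf hp (hn0 n) hA
    have b3' := b3 x₀ hx₀
    have hS0 : 0 ≤ S := norm_nonneg _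
    have h5 : ε n * S ≤ 1 / 22 * S := mul_le_mul_of_nonneg_right hεn.le hS0
    change S ≤ 11 * (L n + _) at b3'
    change _ ≤ 6 * (L n + _) at b2
    have h6 : S ≤ 22 * (1 + ‖w‖) * L n := by linarith
    refine ⟨(hSle n ⟨le_rfl, hn1 n⟩).trans h6, ?_⟩
    linarith
  constructor
  · refine squeeze_zero_norm' (key.mono fun n hn => hn.1) ?_
    simpa using hL.const_mul (22 * (1 + ‖w‖))
  · refine squeeze_zero_norm' (key.mono fun n hn => hn.2) ?_
    have := ((hL.const_mul (1 + ‖w‖)).add (hL.const_mul (22 * (1 + ‖w‖)))).const_mul 6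
    simpa using this

/-! ### Eigenfunctions and matching at the edge of the barrier -/

/-- An eigenvalue of the barrier operator has a nonzero square-integrable classical (Carathéodory)
eigenfunction. -/
theorem exists_eigenfunction {q : ℝ → ℂ} {γ R : ℝ} {z : ℂ}
    (h : IsEigenvalue (barrierOp q γ R) z) :
    ∃ f p r : ℝ → ℂ, HasACDeriv f p ∧ HasACDeriv p r ∧ f 0 = 0 ∧ (∃ x, 0 ≤ x ∧ f x ≠ 0) ∧
      IntegrableOn (fun t => ‖f t‖ ^ 2) (Ioi 0) ∧
      ∀ᵐ t : ℝ, 0 < t →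
        r t = (q t + Complex.I * γ * (Icc (0 : ℝ) R).indicator 1 t - z) * f t := by
  obtain ⟨u, hu0, hu⟩ := h
  have hmem : ((u : L2HalfLine), barrierOp q γ R u) ∈ (barrierOp q γ R).graph :=
    LinearPMap.mem_graph _ u
  rw [hu] at hmem
  obtain ⟨f, p, r, huf, h0, hf, hp, hw⟩ := mem_graph_schrodingerOp.1 hmem
  refine ⟨f, p, r, hf, hp, h0, ?_, ?_, ?_⟩
  · by_contra! hz
    apply hu0
    apply Subtype.ext
    change (u : L2HalfLine) = 0
    rw [Lp.eq_zero_iff_ae_eq_zero]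
    filter_upwards [huf, ae_restrict_mem measurableSet_Ioi] with t ht ht0
    rw [ht, hz t (le_of_lt ht0), Pi.zero_apply]
  · have h1 := (memLp_two_iff_integrable_sq_norm (Lp.aestronglyMeasurable (u : L2HalfLine))).1
      (Lp.memLp (u : L2HalfLine))
    refine h1.congr ?_
    filter_upwards [huf] with t ht
    rw [ht]
  · have h1 := (hw.and (huf.and (Lp.coeFn_smul z (u : L2HalfLine))))
    have h2 := (ae_restrict_iff' measurableSet_Ioi).1 h1
    filter_upwards [h2] with t ht ht0
    obtain ⟨e1, e2, e3⟩ := ht ht0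
    rw [e3, Pi.smul_apply, e2, smul_eq_mul] at e1
    linear_combination e1

/-- The matching conditions at the edge `R` of the barrier, for `m² = z - iγ` and `k² = z`. -/
theorem exists_matching_data {q : ℝ → ℂ} (hq : IntegrableOn q (Ioi 0)) {γ R : ℝ} (hR : 0 < R)
    {z m k : ℂ} (hmz : m ^ 2 = z - Complex.I * γ) (hkz : k ^ 2 = z) (hm : 0 ≤ m.im) (hk : 0 ≤ k.im)
    (hm0 : 0 < ‖m‖) (hk0 : 0 < ‖k‖) (hmQ : 2 * ∫ t in Ioi (0 : ℝ), ‖q t‖ ≤ ‖m‖)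
    (hkQ : 2 * ∫ t in Ioi (0 : ℝ), ‖q t‖ ≤ ‖k‖) (h : IsEigenvalue (barrierOp q γ R) z) :
    ∃ P u v : ℂ, P ≠ 0 ∧
      ‖Complex.exp (Complex.I * m * R) * (u - Complex.I * m * v) - P‖
        ≤ 2 * ‖P‖ / ‖m‖ * ∫ t in Ioi (0 : ℝ), ‖q t‖ ∧
      ‖Complex.exp (Complex.I * m * R) * (u + Complex.I * m * v)
        - Complex.exp (Complex.I * m * R) ^ 2 * P‖
        ≤ 2 * ‖P‖ / ‖m‖ * ∫ t in Ioi (0 : ℝ), ‖q t‖ ∧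
      ‖Complex.exp (Complex.I * m * R)‖ * ‖v‖ ≤ 2 * ‖P‖ / ‖m‖ ∧
      ‖u - Complex.I * k * v‖
        ≤ (∫ t in Ioi (0 : ℝ), ‖q t‖) / ‖k‖ * ‖u + Complex.I * k * v‖ := by
  obtain ⟨f, p, r, hf, hp, h0, ⟨x, hx0, hx⟩, hL2, hr⟩ := exists_eigenfunction h
  have hrm : ∀ᵐ t : ℝ, t ∈ Ioc 0 R → r t = (q t - m ^ 2) * f t := by
    filter_upwards [hr] with t ht ht'
    rw [ht ht'.1, indicator_of_mem (show t ∈ Icc 0 R from ⟨ht'.1.le, ht'.2⟩), hmz, Pi.one_apply]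
    ring
  have hrk : ∀ᵐ t : ℝ, R < t → r t = (q t - k ^ 2) * f t := by
    filter_upwards [hr] with t ht ht'
    rw [ht (hR.trans ht'), indicator_of_notMem (fun hc => absurd hc.2 (not_le.2 ht')), hkz]
    ring
  obtain ⟨hf0, hp0⟩ := tendsto_zero_of_sq_integrable hf hp hq hrk hL2
  obtain ⟨a1, a2, a3⟩ := dirichlet_solution_bounds hf hp hq hm hm0 hmQ hR.le h0 hrm
  obtain ⟨b1, b2⟩ := decaying_solution_bounds hf hp hq hk hk0 hkQ hR.le hrk hf0 hp0
  -- The estimates are homogeneous in `f'(0)`. If it vanished, they would force `f = 0` on `[0,R]`,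
  -- then `f'(R) = 0`, then `f = 0` beyond `R`; no separate uniqueness theorem is needed.
  refine ⟨p 0, p R, f R, fun hP => hx ?_, a1, a2, a3 R ⟨hR.le, le_rfl⟩, b2⟩
  have hin : ∀ y ∈ Icc 0 R, f y = 0 := by
    intro y hy
    have h1 := a3 y hy
    rw [hP, norm_zero, mul_zero, zero_div] at h1
    have h2 := le_antisymm h1 (by positivity)
    rcases mul_eq_zero.1 h2 with h3 | h3
    · exact absurd (norm_eq_zero.1 h3) (Complex.exp_ne_zero _)
    · exact norm_eq_zero.1 h3
  rcases le_total x R with hxR | hxR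
  · exact hin x ⟨hx0, hxR⟩
  · have hfR := hin R ⟨hR.le, le_rfl⟩
    have hpR : p R = 0 := by
      rw [hP, hfR, norm_zero, mul_zero, mul_zero, zero_div, zero_mul, sub_zero,
        sub_zero] at a1
      exact (mul_eq_zero.1 (norm_le_zero_iff.1 a1)).resolve_left (Complex.exp_ne_zero _)
    have h1 := b1 x hxR
    rw [hfR, hpR, mul_zero, add_zero, norm_zero, zero_div] at h1
    exact norm_le_zero_iff.1 h1

/-! ### Choice of the square roots -/

/-- Two square roots `m`, `k` at an acute angle are close when their squares are. -/
theorem norm_sub_le_of_re_mul_nonneg {m k : ℂ} {γ : ℝ} (hm0 : 0 < ‖m‖)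
    (hd : ‖m ^ 2 - k ^ 2‖ ≤ γ) (h : 0 ≤ m.re * k.re + m.im * k.im) : ‖m - k‖ ≤ γ / ‖m‖ := by
  have h1 : ‖m‖ ≤ ‖m + k‖ := by
    rw [← sq_le_sq₀ (norm_nonneg _) (norm_nonneg _), Complex.sq_norm, Complex.sq_norm,
      Complex.normSq_apply, Complex.normSq_apply, Complex.add_re, Complex.add_im]
    nlinarith [sq_nonneg k.re, sq_nonneg k.im]
  rw [le_div_iff₀ hm0]
  calc ‖m - k‖ * ‖m‖ ≤ ‖m - k‖ * ‖m + k‖ := by gcongr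
    _ = ‖m ^ 2 - k ^ 2‖ := by rw [← norm_mul]; congr 1; ring
    _ ≤ γ := hd

/-- As `Im k² = 2 Re k Im k`, the sign of `Im w` decides which pair of opposite quadrants holds the
two roots, and one of `±k` lies in the upper one. -/
theorem exists_sqrt_re_nonneg {w : ℂ} (hw : 0 ≤ w.im) :
    ∃ k : ℂ, k ^ 2 = w ∧ 0 ≤ k.re ∧ 0 ≤ k.im := by
  obtain ⟨k, hk⟩ := IsAlgClosed.exists_pow_nat_eq w (n := 2) (by norm_num)
  have him : w.im = 2 * (k.re * k.im) := by
    rw [← hk, pow_two, Complex.mul_im]; ring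
  have hmul : 0 ≤ k.re * k.im := by linarith
  rcases mul_nonneg_iff.1 hmul with h | h
  · exact ⟨k, hk, h.1, h.2⟩
  · exact ⟨-k, by rw [neg_sq, hk], by simpa using h.1, by simpa using h.2⟩

theorem exists_sqrt_re_nonpos {w : ℂ} (hw : w.im ≤ 0) :
    ∃ k : ℂ, k ^ 2 = w ∧ k.re ≤ 0 ∧ 0 ≤ k.im := by
  obtain ⟨k, hk⟩ := IsAlgClosed.exists_pow_nat_eq w (n := 2) (by norm_num)
  have him : w.im = 2 * (k.re * k.im) := by
    rw [← hk, pow_two, Complex.mul_im]; ring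
  have hmul : k.re * k.im ≤ 0 := by linarith
  rcases mul_nonpos_iff.1 hmul with h | h
  · exact ⟨-k, by rw [neg_sq, hk], by simpa using h.1, by simpa using h.2⟩
  · exact ⟨k, hk, h.1, h.2⟩

theorem sq_re_eq (k : ℂ) : (k ^ 2).re = k.re ^ 2 - k.im ^ 2 := by
  rw [pow_two, Complex.mul_re]; ring

/-- Outside the strip, the square roots of `z - iγ` and `z` in the upper half-plane can be chosen at
an acute angle. -/
theorem exists_acute_sqrts {z : ℂ} {γ : ℝ} (hγ : 0 ≤ γ) (hz : z ∉ strip γ) :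
    ∃ m k : ℂ, m ^ 2 = z - Complex.I * γ ∧ k ^ 2 = z ∧ 0 ≤ m.im ∧ 0 ≤ k.im ∧
      0 ≤ m.re * k.re + m.im * k.im := by
  have him : (z - Complex.I * γ).im = z.im - γ := by simp
  have hre : (z - Complex.I * γ).re = z.re := by simp
  -- Above the strip both roots can be taken in the first quadrant, below it both in the second. At
  -- intermediate heights with `Re z ≤ 0`, both lie within 45° of the positive imaginary axis.
  by_cases h1 : γ ≤ z.im
  · obtain ⟨m, hm, m1, m2⟩ := exists_sqrt_re_nonneg (w := z - Complex.I * γ) (by linarith)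
    obtain ⟨k, hk, k1, k2⟩ := exists_sqrt_re_nonneg (w := z) (hγ.trans h1)
    exact ⟨m, k, hm, hk, m2, k2, by positivity⟩
  by_cases h2 : z.im ≤ 0
  · obtain ⟨m, hm, m1, m2⟩ := exists_sqrt_re_nonpos (w := z - Complex.I * γ) (by linarith)
    obtain ⟨k, hk, k1, k2⟩ := exists_sqrt_re_nonpos (w := z) h2
    exact ⟨m, k, hm, hk, m2, k2,
      add_nonneg (mul_nonneg_of_nonpos_of_nonpos m1 k1) (mul_nonneg m2 k2)⟩
  have hex : ∀ w : ℂ, ∃ k : ℂ, k ^ 2 = w ∧ 0 ≤ k.im := fun w => by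
    rcases le_total 0 w.im with h | h
    · obtain ⟨k, hk, -, k2⟩ := exists_sqrt_re_nonneg h
      exact ⟨k, hk, k2⟩
    · obtain ⟨k, hk, -, k2⟩ := exists_sqrt_re_nonpos h
      exact ⟨k, hk, k2⟩
  obtain ⟨m, hm, m2⟩ := hex (z - Complex.I * γ)
  obtain ⟨k, hk, k2⟩ := hex z
  refine ⟨m, k, hm, hk, m2, k2, ?_⟩
  by_cases h3 : z.re ≤ 0
  · have e1 := sq_re_eq m
    have e2 := sq_re_eq k
    rw [hm, hre] at e1
    rw [hk] at e2
    have a1 : |m.re| ≤ m.im := abs_le_of_sq_le_sq (by linarith) m2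
    have a2 : |k.re| ≤ k.im := abs_le_of_sq_le_sq (by linarith) k2
    have a3 := mul_le_mul a1 a2 (abs_nonneg _) m2
    rw [← abs_mul] at a3
    linarith [neg_abs_le (m.re * k.re)]
  · exact absurd ⟨not_le.1 h3, not_le.1 h2, not_le.1 h1⟩ hz

theorem norm_cexp_I_mul_le_one {m : ℂ} {R : ℝ} (hm : 0 ≤ m.im) (hR : 0 ≤ R) :
    ‖Complex.exp (Complex.I * m * R)‖ ≤ 1 := by
  rw [norm_cexp_I_mul]
  exact Real.exp_le_one_iff.2 (by have := mul_nonneg hm hR; linarith)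

/-! ### The acute and obtuse cases -/

/-- No large eigenvalue has square roots `m`, `k` at an acute angle. -/
theorem not_isEigenvalue_of_acute {q : ℝ → ℂ} (hq : IntegrableOn q (Ioi 0)) {γ R : ℝ} (hγ : 0 < γ)
    (hR : 0 < R) {z m k : ℂ} (hmz : m ^ 2 = z - Complex.I * γ) (hkz : k ^ 2 = z)
    (hm : 0 ≤ m.im) (hk : 0 ≤ k.im) (hmk : 0 ≤ m.re * k.re + m.im * k.im)
    (hmN : 16 * (∫ t in Ioi (0 : ℝ), ‖q t‖) + 16 * γ + 1 ≤ ‖m‖)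
    (hkN : 16 * (∫ t in Ioi (0 : ℝ), ‖q t‖) + 16 * γ + 1 ≤ ‖k‖) :
    ¬ IsEigenvalue (barrierOp q γ R) z := by
  intro h
  have hQ0 : 0 ≤ ∫ t in Ioi (0 : ℝ), ‖q t‖ := integral_nonneg fun t => norm_nonneg _
  have hm0 : 0 < ‖m‖ := by linarith
  have hk0 : 0 < ‖k‖ := by linarith
  obtain ⟨P, u, v, hP, h1, h2, h3, h4⟩ := exists_matching_data hq hR hmz hkz hm hk hm0 hk0
    (by linarith) (by linarith) h
  set Q := ∫ t in Ioi (0 : ℝ), ‖q t‖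
  have hE1 := norm_cexp_I_mul_le_one hm hR.le
  set E := Complex.exp (Complex.I * m * R)
  have hP0 : 0 < ‖P‖ := norm_pos_iff.2 hP
  have hδ : 2 * ‖P‖ / ‖m‖ * Q ≤ ‖P‖ / 8 := by
    rw [div_mul_eq_mul_div, div_le_iff₀ hm0]
    nlinarith
  have hd : ‖m - k‖ ≤ γ / ‖m‖ := norm_sub_le_of_re_mul_nonneg hm0 (by
    rw [hmz, hkz]; simp [abs_of_pos hγ]) hmk
  have hd' : ‖m - k‖ ≤ 1 / 16 := hd.trans (by rw [div_le_iff₀ hm0]; linarith)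
  have hv : ‖E‖ * ‖v‖ ≤ 2 * ‖P‖ := h3.trans (div_le_self (by positivity) (by linarith))
  have hc : ‖Complex.I * (m - k) * (E * v)‖ ≤ ‖P‖ / 8 := by
    rw [norm_mul, norm_mul, norm_mul, Complex.norm_I, one_mul]
    calc _ ≤ 1 / 16 * (2 * ‖P‖) := by gcongr
      _ = _ := by ring
  have hη : ‖E * (u - Complex.I * k * v)‖ ≤ 1 / 2 * ‖E * (u + Complex.I * k * v)‖ := by
    rw [norm_mul, norm_mul]
    have h5 : Q / ‖k‖ ≤ 1 / 2 := by rw [div_le_iff₀ hk0]; linarith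
    have h6 := h4.trans (mul_le_mul_of_nonneg_right h5 (norm_nonneg _))
    have := mul_le_mul_of_nonneg_left h6 (norm_nonneg E)
    linarith
  have hE2 : ‖E ^ 2 * P‖ ≤ ‖P‖ := by
    rw [norm_mul, norm_pow]
    exact mul_le_of_le_one_left (norm_nonneg _) (pow_le_one₀ (norm_nonneg _) hE1)
  have hlow : ‖P‖ ≤ ‖E * (u - Complex.I * k * v)‖ + ‖Complex.I * (m - k) * (E * v)‖
      + ‖E * (u - Complex.I * m * v) - P‖ := by
    have e : P = E * (u - Complex.I * k * v) - Complex.I * (m - k) * (E * v)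
      - (E * (u - Complex.I * m * v) - P) := by ring
    nth_rewrite 1 [e]
    exact (norm_sub_le _ _).trans (add_le_add_left (norm_sub_le _ _) _)
  have hupp : ‖E * (u + Complex.I * k * v)‖ ≤ ‖E * (u + Complex.I * m * v) - E ^ 2 * P‖
      + ‖E ^ 2 * P‖ + ‖Complex.I * (m - k) * (E * v)‖ := by
    have e : E * (u + Complex.I * k * v) = (E * (u + Complex.I * m * v) - E ^ 2 * P) + E ^ 2 * P
      - Complex.I * (m - k) * (E * v) := by ring
    rw [e]
    exact (norm_sub_le _ _).trans (add_le_add_left (norm_add_le _ _) _)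
  -- The errors are at most `|P|/8` each, so `|P| ≤ (1/2)(5/4)|P| + |P|/8 + |P|/8 = (7/8)|P|`, a
  -- contradiction.
  linarith

/-- At a large eigenvalue whose square roots `m`, `k` are at an obtuse angle, the barrier must damp
the mode `exp(imx)` down to size `|m|^{-1/2}`. -/
theorem exp_le_of_obtuse {q : ℝ → ℂ} (hq : IntegrableOn q (Ioi 0)) {γ R : ℝ} (hγ : 0 < γ)
    (hR : 0 < R) {z m k : ℂ} (hmz : m ^ 2 = z - Complex.I * γ) (hkz : k ^ 2 = z)
    (hm : 0 ≤ m.im) (hk : 0 ≤ k.im) (hmk : m.re * k.re + m.im * k.im ≤ 0)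
    (hmN : 16 * (∫ t in Ioi (0 : ℝ), ‖q t‖) + 16 * γ + 1 ≤ ‖m‖)
    (h : IsEigenvalue (barrierOp q γ R) z) :
    Real.exp (-(2 * m.im * R)) ≤ (5 * (∫ t in Ioi (0 : ℝ), ‖q t‖) + 2 * γ) / ‖m‖ := by
  have hQ0 : 0 ≤ ∫ t in Ioi (0 : ℝ), ‖q t‖ := integral_nonneg fun t => norm_nonneg _
  have hm0 : 0 < ‖m‖ := by linarith
  have hd : ‖m + k‖ ≤ γ / ‖m‖ := by
    have := norm_sub_le_of_re_mul_nonneg (k := -k) (γ := γ) hm0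
      (by rw [neg_sq, hmz, hkz]; simp [abs_of_pos hγ])
      (by rw [Complex.neg_re, Complex.neg_im]; linarith)
    rwa [sub_neg_eq_add] at this
  have hd' : ‖m + k‖ ≤ 1 / 16 := hd.trans (by rw [div_le_iff₀ hm0]; linarith)
  have hkm : ‖m‖ / 2 ≤ ‖k‖ := by
    have := norm_le_add_norm_add m k
    linarith
  have hk0 : 0 < ‖k‖ := by linarith
  obtain ⟨P, u, v, hP, h1, h2, h3, h4⟩ := exists_matching_data hq hR hmz hkz hm hk hm0 hk0
    (by linarith) (by linarith) h
  have hEsq : ‖Complex.exp (Complex.I * m * R)‖ ^ 2 = Real.exp (-(2 * m.im * R)) := by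
    rw [norm_cexp_I_mul, ← Real.exp_nat_mul]; congr 1; push_cast; ring
  set Q := ∫ t in Ioi (0 : ℝ), ‖q t‖
  have hE1 := norm_cexp_I_mul_le_one hm hR.le
  set E := Complex.exp (Complex.I * m * R)
  have hP0 : 0 < ‖P‖ := norm_pos_iff.2 hP
  have hδ : 2 * ‖P‖ / ‖m‖ * Q = 2 * Q / ‖m‖ * ‖P‖ := by ring
  have hδ' : 2 * Q / ‖m‖ * ‖P‖ ≤ 1 / 8 * ‖P‖ := by
    refine mul_le_mul_of_nonneg_right ?_ hP0.le
    rw [div_le_iff₀ hm0]; linarith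
  have hv : ‖E‖ * ‖v‖ ≤ 2 * ‖P‖ := h3.trans (div_le_self (by positivity) (by linarith))
  have hc : ‖Complex.I * (m + k) * (E * v)‖ ≤ 2 * γ / ‖m‖ * ‖P‖ := by
    rw [norm_mul, norm_mul, norm_mul, Complex.norm_I, one_mul]
    calc _ ≤ γ / ‖m‖ * (2 * ‖P‖) := by gcongr
      _ = _ := by ring
  have hc' : 2 * γ / ‖m‖ * ‖P‖ ≤ 1 / 8 * ‖P‖ := by
    refine mul_le_mul_of_nonneg_right ?_ hP0.le
    rw [div_le_iff₀ hm0]; linarith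
  have hη : ‖E * (u - Complex.I * k * v)‖ ≤ 2 * Q / ‖m‖ * ‖E * (u + Complex.I * k * v)‖ := by
    rw [norm_mul, norm_mul]
    have h5 : Q / ‖k‖ ≤ 2 * Q / ‖m‖ := by
      rw [div_le_div_iff₀ hk0 hm0]
      nlinarith
    have h6 := h4.trans (mul_le_mul_of_nonneg_right h5 (norm_nonneg _))
    calc _ ≤ ‖E‖ * (2 * Q / ‖m‖ * ‖u + Complex.I * k * v‖) := by gcongr
      _ = _ := by ring
  -- Since `k ≈ -m`, `u + ikv` is close to `u - imv`, which carries `P`; `u - ikv` is close to `u +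
  -- imv`, which carries `E²P`.
  have hupp : ‖E * (u + Complex.I * k * v)‖ ≤ ‖E * (u - Complex.I * m * v) - P‖
      + ‖P‖ + ‖Complex.I * (m + k) * (E * v)‖ := by
    have e : E * (u + Complex.I * k * v) = (E * (u - Complex.I * m * v) - P) + P
      + Complex.I * (m + k) * (E * v) := by ring
    rw [e]
    exact norm_add₃_le
  have hlow : ‖E ^ 2 * P‖ ≤ ‖E * (u - Complex.I * k * v)‖ + ‖Complex.I * (m + k) * (E * v)‖
      + ‖E * (u + Complex.I * m * v) - E ^ 2 * P‖ := by
    have e : E ^ 2 * P = E * (u - Complex.I * k * v) + Complex.I * (m + k) * (E * v)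
      - (E * (u + Complex.I * m * v) - E ^ 2 * P) := by ring
    nth_rewrite 1 [e]
    exact (norm_sub_le _ _).trans (add_le_add_left (norm_add_le _ _) _)
  rw [norm_mul, norm_pow, hEsq] at hlow
  rw [hδ] at h1 h2
  have hupp' : ‖E * (u + Complex.I * k * v)‖ ≤ 5 / 4 * ‖P‖ := by linarith
  have hη' : ‖E * (u - Complex.I * k * v)‖ ≤ 5 / 2 * Q / ‖m‖ * ‖P‖ := by
    refine hη.trans ?_
    calc _ ≤ 2 * Q / ‖m‖ * (5 / 4 * ‖P‖) := by gcongr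
      _ = _ := by ring
  refine le_of_mul_le_mul_right ?_ hP0
  calc _ ≤ 5 / 2 * Q / ‖m‖ * ‖P‖ + 2 * γ / ‖m‖ * ‖P‖ + 2 * Q / ‖m‖ * ‖P‖ := by linarith
    _ = (9 / 2 * Q + 2 * γ) / ‖m‖ * ‖P‖ := by ring
    _ ≤ _ := by gcongr; linarith

/-! ### Size of the barrier's damping, and conclusion -/

/-- `Re m² ≥ 0` gives `|Re m| ≥ |m|/√2`, and `2|Re m| Im m = -Im m² ≤ γ`. The number 7/5 is a
rational lower bound for `√2`. -/
theorem im_mul_norm_le {m : ℂ} {γ : ℝ} (hre : 0 ≤ (m ^ 2).re)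
    (him : -γ ≤ (m ^ 2).im) (h1 : m.re ≤ 0) (h2 : 0 ≤ m.im) : 7 / 5 * ‖m‖ * m.im ≤ γ := by
  rw [sq_re_eq] at hre
  rw [pow_two, Complex.mul_im] at him
  have h3 : 7 / 10 * ‖m‖ ≤ -m.re := by
    refine le_of_sq_le_sq ?_ (by linarith)
    rw [mul_pow, Complex.sq_norm, Complex.normSq_apply]
    nlinarith [sq_nonneg m.re]
  nlinarith

/-- For large `R`, the quantity `5γR / log R` exceeds any constant and `(log R / R)`-multiples are
beaten by `R^{-3/10}`. -/
theorem eventually_barrier_length {γ N C : ℝ} (hγ : 0 < γ) :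
    ∀ᶠ R : ℝ in atTop, 1 < R ∧ N * Real.log R ≤ 5 * γ * R ∧
      C * Real.log R < 5 * γ * R * Real.exp (-(3 / 10 * Real.log R)) := by
  -- 7/10 = 1 - 3/10: `R exp(-(3/10) log R) = R^(7/10)`, which still dominates `log R`.
  have h1 := (isLittleO_log_rpow_atTop (r := 7 / 10) (by norm_num)).tendsto_div_nhds_zero
  have h2 : Tendsto (fun R : ℝ => C * (Real.log R / R ^ (7 / 10 : ℝ))) atTop (𝓝 0) := by
    simpa using h1.const_mul C
  have h3 : Tendsto (fun R : ℝ => N * (Real.log R / R ^ (7 / 10 : ℝ))) atTop (𝓝 0) := by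
    simpa using h1.const_mul N
  filter_upwards [h2.eventually_lt_const (show 0 < 5 * γ by positivity),
    h3.eventually_lt_const (show 0 < 5 * γ by positivity), eventually_gt_atTop 1] with R a b hR
  have hR0 : 0 < R := by linarith
  have hp : 0 < R ^ (7 / 10 : ℝ) := Real.rpow_pos_of_pos hR0 _
  rw [← mul_div_assoc, div_lt_iff₀ hp] at a b
  refine ⟨hR, b.le.trans ?_, a.trans_le (le_of_eq ?_)⟩
  · have : R ^ (7 / 10 : ℝ) ≤ R := by
      simpa using Real.rpow_le_rpow_of_exponent_le hR.le (show (7 / 10 : ℝ) ≤ 1 by norm_num)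
    gcongr
  · have : R ^ (7 / 10 : ℝ) = R * Real.exp (-(3 / 10 * Real.log R)) := by
      rw [Real.rpow_def_of_pos hR0]
      nth_rewrite 2 [← Real.exp_log hR0]
      rw [← Real.exp_add]; congr 1; ring
    rw [this]; ring

theorem theorem2p4 (q : ℝ → ℂ) (hq : IntegrableOn q (Ioi 0)) (γ : ℝ) (hγ : 0 < γ) :
    (∃ X : ℝ, 0 < X ∧ ∀ R : ℝ, 0 < R → ∀ z : ℂ, IsEigenvalue (barrierOp q γ R) z →
      z ∈ Metric.ball (0 : ℂ) X ∪ strip γ) ∧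
    (∃ R₀ : ℝ, 1 < R₀ ∧ ∀ R : ℝ, R₀ ≤ R → ∀ z : ℂ, IsEigenvalue (barrierOp q γ R) z →
      z ∈ strip γ → √‖z - Complex.I * γ‖ ≤ 5 * γ * R / Real.log R) := by
  have hQ0 : 0 ≤ ∫ t in Ioi (0 : ℝ), ‖q t‖ := integral_nonneg fun t => norm_nonneg _
  constructor
  · set N := 16 * (∫ t in Ioi (0 : ℝ), ‖q t‖) + 16 * γ + 1 with hN
    have hN0 : 0 < N := by positivity
    -- `|z| ≥ N² + γ` makes both `|m|² ≥ |z| - γ` and `|k|² = |z|` at least `N²`.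
    refine ⟨N ^ 2 + γ, by positivity, fun R hR z hz => ?_⟩
    by_contra hc
    rw [mem_union, not_or, Metric.mem_ball, dist_zero_right, not_lt] at hc
    obtain ⟨hball, hstrip⟩ := hc
    obtain ⟨m, k, hmz, hkz, hm, hk, hmk⟩ := exists_acute_sqrts hγ.le hstrip
    refine not_isEigenvalue_of_acute hq hγ hR hmz hkz hm hk hmk ?_ ?_ hz
    · rw [← hN, ← sq_le_sq₀ hN0.le (norm_nonneg _), ← norm_pow, hmz]
      have h1 := norm_sub_norm_le z (Complex.I * γ)
      have h2 : ‖Complex.I * (γ : ℂ)‖ = γ := by simp [abs_of_pos hγ]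
      linarith
    · rw [← hN, ← sq_le_sq₀ hN0.le (norm_nonneg _), ← norm_pow, hkz]
      linarith
  · obtain ⟨R₀, hR₀⟩ := eventually_atTop.1 (eventually_barrier_length
      (N := 16 * (∫ t in Ioi (0 : ℝ), ‖q t‖) + 16 * γ + 1)
      (C := 5 * (∫ t in Ioi (0 : ℝ), ‖q t‖) + 2 * γ) hγ)
    refine ⟨R₀, (hR₀ R₀ le_rfl).1, fun R hR z hz hstrip => ?_⟩
    obtain ⟨hR1, hRN, hRC⟩ := hR₀ R hR
    obtain ⟨hre, him0, himγ⟩ := hstrip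
    have hlog : 0 < Real.log R := Real.log_pos hR1
    have hR0 : 0 < R := by linarith
    have e1 : (z - Complex.I * γ).im = z.im - γ := by simp
    have e2 : (z - Complex.I * γ).re = z.re := by simp
    -- In the strip `m` falls in the second quadrant and `k` in the first. As `Re z > 0`, both are
    -- within 45° of the real axis, hence at an obtuse (or right) angle.
    obtain ⟨m, hmz, m1, m2⟩ := exists_sqrt_re_nonpos (w := z - Complex.I * γ) (by linarith)
    obtain ⟨k, hkz, k1, k2⟩ := exists_sqrt_re_nonneg (w := z) him0.le
    rw [← hmz, norm_pow, Real.sqrt_sq (norm_nonneg _)]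
    by_contra! hlt
    rw [div_lt_iff₀ hlog] at hlt
    have hmN : 16 * (∫ t in Ioi (0 : ℝ), ‖q t‖) + 16 * γ + 1 ≤ ‖m‖ :=
      le_of_mul_le_mul_right (hRN.trans hlt.le) hlog
    have hm0 : 0 < ‖m‖ := by linarith
    have hmk : m.re * k.re + m.im * k.im ≤ 0 := by
      have s1 := sq_re_eq m
      have s2 := sq_re_eq k
      rw [hmz, e2] at s1
      rw [hkz] at s2
      have a1 : m.im ≤ -m.re := abs_le_of_sq_le_sq' (by nlinarith) (by linarith) |>.2
      have a2 : k.im ≤ k.re := abs_le_of_sq_le_sq' (by nlinarith) k1 |>.2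
      nlinarith [mul_le_mul a1 a2 k2 (by linarith)]
    have hexp := exp_le_of_obtuse hq hγ hR0 hmz hkz m2 k2 hmk hmN hz
    have him := im_mul_norm_le (γ := γ) (by rw [hmz, e2]; exact hre.le) (by rw [hmz, e1]; linarith)
      m1 m2
    -- `5 · 7/5 = 7`, so `7R Im m < log R` and `2R Im m` is below `(2/7) log R`; 2/7 < 3/10.
    have hRm : 2 * m.im * R ≤ 3 / 10 * Real.log R := by
      have b1 : 5 * (7 / 5 * ‖m‖ * m.im) * R < ‖m‖ * Real.log R := by
        refine lt_of_le_of_lt ?_ hlt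
        gcongr
      have b2 : 7 * (m.im * R) < Real.log R := by
        refine lt_of_mul_lt_mul_left ?_ hm0.le
        linarith
      linarith
    have hexp' : Real.exp (-(3 / 10 * Real.log R)) ≤ Real.exp (-(2 * m.im * R)) :=
      Real.exp_le_exp.2 (by linarith)
    -- Now `R^(-3/10)|m| ≤ 5Q + 2γ`, which contradicts `|m| > 5γR/log R` by the choice of `R₀`.
    have hfin := hexp'.trans hexp
    rw [le_div_iff₀ hm0] at hfin
    have c1 := mul_le_mul_of_nonneg_right hfin hlog.le
    have c2 := mul_lt_mul_of_pos_left hlt (Real.exp_pos (-(3 / 10 * Real.log R)))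
    linarith
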